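/- **Theorem** (Khoussainov, Rubin, Stephan; 2003). If $\mathcal T=(T;\le)$ is a word-automatic partial-order tree, then its Cantor–Bendixson rank $CB(\mathcal T)$ is finite. Here a *(partial-order) tree* is a partial order $(T;\le)$ with a least element in which, for every $x\in T$, the set of $\le$-predecessors of $x$ is finite and linearly ordered. It is not assumed to be finitely branching or to have only countably many infinite paths. The *convolution* of words $x_1,\dots,x_k\in\Sigma^\star$ over a finite alphabet $\Sigma$ is the word over $(\Sigma\cup\{\Diamond\})^k$ obtained by padding the $x_i$ at the end with a new symbol $\Diamond$ to the length of the longest of them and reading them in parallel. A $k$-ary relation on $\Sigma^\star$ is *regular* if the set of convolutions of its elements is a regular language. The structure $(T;\le)$ is *word-automatic* if, up to isomorphism, $T\subseteq\Sigma^\star$ is a regular language for some finite alphabet $\Sigma$ and $\le$ is a regular relation on $\Sigma^\star$. For a set $S\subseteq T$, an *infinite path* of $S$ is an infinite, linearly ordered subset of $S$ that contains with each of its elements all predecessors of that element in $S$. The *derivative* $d(S)$ is the set of all $x$ that belong to two distinct infinite paths of $S$. Put $d^0(\mathcal T)=T$, $d^{\alpha+1}(\mathcal T)=d(d^\alpha(\mathcal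 T))$, and $d^\gamma(\mathcal T)=\bigcap_{\beta<\gamma}d^\beta(\mathcal T)$ for limit ordinals $\gamma$. The *Cantor–Bendixson rank* $CB(\mathcal T)$ is the least ordinal $\alpha$ with $d^\alpha(\mathcal T)=d^{\alpha+1}(\mathcal T)$. -/

import Mathlib

/-! ### Regular relations on words and word-automatic orders -/

namespace WordAutomatic

/-- The convolution of a `k`-tuple of words: the word, as long as the longest component, whose
`j`-th letter is the tuple of the `j`-th letters of the components; `none` is the padding symbol,
used at the positions after the end of a component. -/
def convolution {A : Type*} {k : ℕ} (w : Fin k → List A) : List (Fin k → Option A) :=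
  (List.range (Finset.univ.sup fun i => (w i).length)).map fun j i => (w i)[j]?

/-- A `k`-ary relation on words is regular if the set of convolutions of its elements is a regular
language (over the alphabet of `k`-tuples of letters or padding symbols). -/
def IsRegularRel {A : Type*} {k : ℕ} (R : Set (Fin k → List A)) : Prop :=
  Language.IsRegular (T := Fin k → Option A) (convolution '' R)

/-- `ρ` names the elements of `T` by words over `A` in such a way that `(T; ≤)` becomes a
word-automatic structure: its domain, the set of names, is a regular language, and its relation
`≤` is a regular relation on words. If `T` is itself a set of words and `ρ` the inclusion, this says
that the structure `(T; ≤)` is word automatic. -/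
structure IsPresentation {A T : Type*} [LE T] (ρ : T → List A) : Prop where
  injective : Function.Injective ρ
  domain_regular : Language.IsRegular (T := A) (Set.range ρ)
  le_regular : IsRegularRel {w : Fin 2 → List A | ∃ x y : T, x ≤ y ∧ w = ![ρ x, ρ y]}

end WordAutomatic

/-! ### Partial-order trees and their Cantor-Bendixson rank -/

namespace PoTree

/-- `(T; ≤)` is a (partial-order) tree: there is a least element, and the predecessors of every
element form a finite linearly ordered set. -/
structure IsTree (T : Type*) [PartialOrder T] : Prop where
  exists_least : ∃ r : T, ∀ x : T, r ≤ x
  isChain_Iic : ∀ x : T, IsChain (· ≤ ·) (Set.Iic x)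
  finite_Iic : ∀ x : T, (Set.Iic x).Finite

universe u

variable {T : Type u} [PartialOrder T]

/-- `P` is an infinite path of the subtree with set of nodes `S`: an infinite, linearly ordered
subset of `S` which contains with every node all its predecessors in `S`. -/
structure IsInfinitePath (S P : Set T) : Prop where
  subset : P ⊆ S
  infinite : P.Infinite
  isChain : IsChain (· ≤ ·) P
  mem_of_le : ∀ x ∈ P, ∀ y ∈ S, y ≤ x → y ∈ P

/-- The derivative of the subtree with set of nodes `S`: the set of all nodes that belong to two
distinct infinite paths of it. -/
def derivative (S : Set T) : Set T :=
  {x | ∃ P Q : Set T, IsInfinitePath S P ∧ IsInfinitePath S Q ∧ P ≠ Q ∧ x ∈ P ∧ x ∈ Q}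

variable (T)

/-- The iterated derivative `d^α(T)`: `d^0(T) = T`, `d^(α+1)(T) = d(d^α(T))`, and
`d^γ(T) = ⋂_{β < γ} d^β(T)` for limit ordinals `γ`. -/
noncomputable def iterDerivative (α : Ordinal.{u}) : Set T :=
  Ordinal.limitRecOn α Set.univ (fun _ S => derivative S)
    (fun γ _ ih => ⋂ (β : Ordinal.{u}) (h : β < γ), ih β h)

/-- The Cantor-Bendixson rank of `T`: the least ordinal `α` with `d^α(T) = d^(α+1)(T)`
(such an ordinal exists, see `iterDerivative_cbRank`). -/
noncomputable def cbRank : Ordinal.{u} :=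
  sInf {α : Ordinal.{u} | iterDerivative T α = iterDerivative T (α + 1)}

theorem iterDerivative_zero : iterDerivative T 0 = Set.univ := by
  simp [iterDerivative]

theorem iterDerivative_add_one (α : Ordinal.{u}) :
    iterDerivative T (α + 1) = derivative (iterDerivative T α) := by
  simp [iterDerivative]

theorem iterDerivative_limit {γ : Ordinal.{u}} (h : Order.IsSuccLimit γ) :
    iterDerivative T γ = ⋂ (β : Ordinal.{u}) (_ : β < γ), iterDerivative T β := by
  simp only [iterDerivative]
  rw [Ordinal.limitRecOn_limit _ _ _ _ h]

theorem derivative_subset {T : Type u} [PartialOrder T] (S : Set T) : derivative S ⊆ S := by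
  rintro x ⟨P, Q, hP, -, -, hx, -⟩
  exact hP.subset hx

theorem iterDerivative_antitone : Antitone (iterDerivative T) := by
  intro α β hab
  induction β using Ordinal.limitRecOn with
  | zero => rw [nonpos_iff_eq_zero.mp hab]
  | add_one β ih =>
    rcases hab.lt_or_eq with h | h
    · rw [iterDerivative_add_one]
      exact (derivative_subset _).trans (ih (Order.lt_add_one_iff.mp h))
    · rw [h]
  | limit γ hγ ih =>
    rcases hab.lt_or_eq with h | h
    · rw [iterDerivative_limit T hγ]
      exact Set.iInter₂_subset α h
    · rw [h]

/-- The minimum in the definition of the Cantor-Bendixson rank is attained. -/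
theorem iterDerivative_cbRank :
    iterDerivative T (cbRank T) = iterDerivative T (cbRank T + 1) := by
  have hne : {α : Ordinal.{u} |
      iterDerivative T α = iterDerivative T (α + 1)}.Nonempty := by
    by_contra hno
    rw [Set.not_nonempty_iff_eq_empty, Set.eq_empty_iff_forall_notMem] at hno
    have key : ∀ α β : Ordinal.{u}, α < β → iterDerivative T α ≠ iterDerivative T β := by
      intro α β hlt heq
      refine hno α (Set.Subset.antisymm ?_ (iterDerivative_antitone T (Order.le_succ α : α ≤ α + 1)))
      rw [heq]
      exact iterDerivative_antitone T (Order.add_one_le_of_lt hlt)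
    refine not_injective_of_ordinal (iterDerivative T) fun α β h => ?_
    rcases lt_trichotomy α β with hlt | heq | hlt
    · exact absurd h (key α β hlt)
    · exact heq
    · exact absurd h.symm (key β α hlt)
  exact csInf_mem hne

end PoTree

/-!
The Cantor-Bendixson rank of a tree is read off from a combinatorial rank of its cones: a set has
rank at least `n + 1` if the rungs of some infinite ladder of cones cut out of it pieces of rank at
least `n`. A node lies on an infinite path of the `n`-th derivative exactly if its cone has rank at
least `n + 1`, so it suffices to find a bound such that every cone of larger rank has every rank.
The combinatorial rank is partition regular. Hence a cone of rank at least `n + 1`, whose root is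
named by a word of length `L`, keeps this rank when only the names extending a suitable word `w` of
length `L` are considered. After `w` has been read, an automaton for `≤` retains only a state, and
so, when `w` varies, there are only finitely many possibilities for the restricted cone together
with the family of the restrictions of all cones.
-/

section LadderRank

variable {α β ι : Type*}

/-- `HasLadderRank F n S`: the set `S` has rank at least `n` with respect to the family `F`. For
`n = 0` this means that `S` is nonempty. Rank at least `n + 1` means that there are `f 0, f 1, …` in
`F` such that, for all `i`, the elements of `S` that belong to `f 0, …, f i` and to no other `f j`
form a set of rank at least `n`. Asking for this incidence pattern instead of a decreasing sequence
makes the rank compatible with taking preimages, see `hasLadderRank_image`. -/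
def HasLadderRank (F : Set (Set α)) : ℕ → Set α → Prop
  | 0, S => S.Nonempty
  | n + 1, S => ∃ f : ℕ → Set α, (∀ i, f i ∈ F) ∧
      ∀ i, HasLadderRank F n (S ∩ {a | ∀ j, a ∈ f j ↔ j ≤ i})

namespace HasLadderRank

variable {F F' : Set (Set α)} {n : ℕ} {S S' : Set α}

theorem mono (h : HasLadderRank F n S) (hS : S ⊆ S') : HasLadderRank F n S' := by
  induction n generalizing S S' with
  | zero => exact Set.Nonempty.mono hS h
  | succ n ih =>
    obtain ⟨f, hf, h⟩ := h
    exact ⟨f, hf, fun i => ih (h i) (Set.inter_subset_inter_left _ hS)⟩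

theorem nonempty (h : HasLadderRank F n S) : S.Nonempty := by
  induction n generalizing S with
  | zero => exact h
  | succ n ih =>
    obtain ⟨f, -, h⟩ := h
    exact (ih (h 0)).mono Set.inter_subset_left

theorem mono_family (h : HasLadderRank F n S) (hF : ∀ G ∈ F, G.Nonempty → G ∈ F') :
    HasLadderRank F' n S := by
  induction n generalizing S with
  | zero => exact h
  | succ n ih =>
    obtain ⟨f, hf, h⟩ := h
    refine ⟨f, fun i => hF _ (hf i) ?_, fun i => ih (h i)⟩
    exact (h i).nonempty.mono fun a ha => (ha.2 i).2 le_rfl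

theorem of_succ (h : HasLadderRank F (n + 1) S) : HasLadderRank F n S := by
  induction n generalizing S with
  | zero => exact h.nonempty
  | succ n ih =>
    obtain ⟨f, hf, h⟩ := h
    exact ⟨f, hf, fun i => ih (h i)⟩

theorem antitone (F : Set (Set α)) (S : Set α) : Antitone fun n => HasLadderRank F n S :=
  antitone_nat_of_succ_le fun _ => of_succ

theorem nontrivial (h : HasLadderRank F (n + 1) S) : S.Nontrivial := by
  obtain ⟨f, -, h⟩ := h
  obtain ⟨a, haS, ha⟩ := (h 0).nonempty
  obtain ⟨b, hbS, hb⟩ := (h 1).nonempty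
  refine ⟨a, haS, b, hbS, ?_⟩
  rintro rfl
  exact absurd ((ha 1).1 ((hb 1).2 le_rfl)) (by norm_num)

theorem exists_fiber [Finite ι] (h : HasLadderRank F n S) (c : α → ι) :
    ∃ i, HasLadderRank F n (S ∩ c ⁻¹' {i}) := by
  induction n generalizing S with
  | zero =>
    obtain ⟨a, ha⟩ := h
    exact ⟨c a, a, ha, rfl⟩
  | succ n ih =>
    obtain ⟨f, hf, h⟩ := h
    choose color hcolor using fun j => ih (h j)
    obtain ⟨i, hi⟩ := Finite.exists_infinite_fiber color
    obtain ⟨e, he⟩ : ∃ e : ℕ ↪o ℕ, ∀ k, color (e k) = i := by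
      classical
      exact ⟨Nat.orderEmbeddingOfSet (color ⁻¹' {i}),
        fun k => (Nat.Subtype.ofNat (color ⁻¹' {i}) k).2⟩
    refine ⟨i, f ∘ e, fun k => hf (e k), fun k => (hcolor (e k)).mono ?_⟩
    rintro a ⟨⟨haS, ha⟩, hac⟩
    exact ⟨⟨haS, he k ▸ hac⟩, fun j => (ha (e j)).trans e.le_iff_le⟩

theorem exists_isPrefix [Finite β] {g : α → List β} (hg : Function.Injective g)
    (h : HasLadderRank F (n + 1) S) (L : ℕ) :
    ∃ w : List β, w.length = L ∧ HasLadderRank F (n + 1) {a ∈ S | w <+: g a} := by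
  have : Finite {w : List β // w.length ≤ L} := (List.finite_length_le β L).to_subtype
  obtain ⟨c, hc⟩ : ∃ c : α → {w : List β // w.length ≤ L}, ∀ a, (c a : List β) = (g a).take L :=
    ⟨fun a => ⟨(g a).take L, List.length_take_le _ _⟩, fun _ => rfl⟩
  obtain ⟨w, hw⟩ := h.exists_fiber c
  have htake {a : α} (ha : c a = w) : (g a).take L = w := ha ▸ (hc a).symm
  refine ⟨w, ?_, hw.mono fun a ha => ⟨ha.1, htake ha.2 ▸ List.take_prefix L (g a)⟩⟩
  -- A word shorter than `L` arises by truncation only from itself, so its fiber is a singleton.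
  by_contra hwL
  have heq {a : α} (ha : c a = w) : g a = w := by
    have hlen : min L (g a).length = (w : List β).length := by
      rw [← htake ha, List.length_take]
    rw [← htake ha, List.take_of_length_le (by omega)]
  obtain ⟨a, ha, b, hb, hab⟩ := hw.nontrivial
  exact hab (hg ((heq ha.2).trans (heq hb.2).symm))

theorem succ_of_antitone {f : ℕ → Set α} (hf : Antitone f) (hfF : ∀ i, f i ∈ F)
    (h : ∀ i, HasLadderRank F n (S ∩ (f i \ f (i + 1)))) : HasLadderRank F (n + 1) S := by
  refine ⟨f, hfF, fun i => (h i).mono (Set.inter_subset_inter_right S ?_)⟩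
  rintro a ⟨hai, hai'⟩ j
  exact ⟨fun haj => not_lt.1 fun hij => hai' (hf hij haj), fun hji => hf hji hai⟩

end HasLadderRank

theorem hasLadderRank_image (g : β → α) {F : Set (Set α)} {n : ℕ} {U : Set β} :
    HasLadderRank F n (g '' U) ↔ HasLadderRank (Set.preimage g '' F) n U := by
  induction n generalizing U with
  | zero => exact Set.image_nonempty
  | succ n ih =>
    have hpiece (f : ℕ → Set α) (i : ℕ) :
        g '' U ∩ {a | ∀ j, a ∈ f j ↔ j ≤ i} =
          g '' (U ∩ {b | ∀ j, b ∈ g ⁻¹' f j ↔ j ≤ i}) :=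
      (Set.image_inter_preimage g U _).symm
    constructor
    · rintro ⟨f, hf, h⟩
      refine ⟨fun i => g ⁻¹' f i, fun i => ⟨f i, hf i, rfl⟩, fun i => ih.1 ?_⟩
      rw [← hpiece]
      exact h i
    · rintro ⟨f', hf', h⟩
      choose f hf hff' using hf'
      obtain rfl : (fun i => g ⁻¹' f i) = f' := funext hff'
      refine ⟨f, hf, fun i => ?_⟩
      rw [hpiece]
      exact ih.2 (h i)

theorem exists_nat_forall_of_antitone {s : Set ι} (hs : s.Finite) {p : ι → ℕ → Prop}
    (hp : ∀ i ∈ s, Antitone (p i)) : ∃ m, ∀ i ∈ s, p i m → ∀ n, p i n := by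
  refine ((Filter.eventually_all_finite (l := Filter.atTop) hs).2 fun i hi => ?_).exists
  by_cases hall : ∀ n, p i n
  · exact .of_forall fun _ _ => hall
  · obtain ⟨N, hN⟩ := not_forall.1 hall
    filter_upwards [Filter.eventually_ge_atTop N] with m hm hpm
    exact absurd (hp i hi hm hpm) hN

end LadderRank

namespace PoTree

/-- The family of the cones `{y | x ≤ y}` of a preorder. -/
def cones (T : Type*) [Preorder T] : Set (Set T) := Set.range Set.Ici

theorem hasLadderRank_succ_Ici_of_forall_exists {T : Type*} [Preorder T] {P : Set T} {n : ℕ}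
    (h : ∀ p ∈ P, ∃ q ∈ P, p ≤ q ∧ HasLadderRank (cones T) n (Set.Ici p \ Set.Ici q)) {x : T}
    (hx : x ∈ P) : HasLadderRank (cones T) (n + 1) (Set.Ici x) := by
  have hstep : ∀ p : P, ∃ q : P, p ≤ q ∧
      HasLadderRank (cones T) n (Set.Ici (p : T) \ Set.Ici (q : T)) := fun p => by
    obtain ⟨q, hq, hpq⟩ := h p p.2
    exact ⟨⟨q, hq⟩, hpq⟩
  choose g hle hrank using hstep
  let y (i : ℕ) : P := g^[i] ⟨x, hx⟩
  have hy : Monotone y := fun i j hij => Function.monotone_iterate_of_id_le hle hij ⟨x, hx⟩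
  refine .succ_of_antitone (f := fun i => Set.Ici (y i : T))
    (fun i j hij => Set.Ici_subset_Ici.2 (hy hij)) (fun i => ⟨_, rfl⟩) fun i => ?_
  have hxy : x ≤ y i := hy i.zero_le
  have hsucc : y (i + 1) = g (y i) := Function.iterate_succ_apply' g i _
  rw [hsucc]
  exact (hrank (y i)).mono fun t ht => ⟨hxy.trans ht.1, ht⟩

variable {T : Type*} [PartialOrder T] {S P Q : Set T}

/-- `(T; ≤)` is a (partial-order) forest: the predecessors of every element form a finite linearly
ordered set. Unlike a tree, a forest may have several minimal elements. -/
structure IsForest (T : Type*) [PartialOrder T] : Prop where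
  isChain_Iic : ∀ x : T, IsChain (· ≤ ·) (Set.Iic x)
  finite_Iic : ∀ x : T, (Set.Iic x).Finite

theorem IsTree.isForest (hT : IsTree T) : IsForest T := ⟨hT.isChain_Iic, hT.finite_Iic⟩

theorem iterDerivative_natCast_succ (n : ℕ) :
    iterDerivative T (n + 1 : ℕ) = derivative (iterDerivative T n) := by
  rw [Nat.cast_succ, iterDerivative_add_one]

theorem isLowerSet_derivative (hS : IsLowerSet S) : IsLowerSet (derivative S) := by
  rintro x y hyx ⟨P, Q, hP, hQ, hne, hxP, hxQ⟩
  have hy : y ∈ S := hS hyx (hP.subset hxP)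
  exact ⟨P, Q, hP, hQ, hne, hP.mem_of_le x hxP y hy hyx, hQ.mem_of_le x hxQ y hy hyx⟩

theorem isLowerSet_iterDerivative_natCast (n : ℕ) : IsLowerSet (iterDerivative T n) := by
  induction n with
  | zero => rw [Nat.cast_zero, iterDerivative_zero]; exact isLowerSet_univ
  | succ n ih => rw [iterDerivative_natCast_succ]; exact isLowerSet_derivative ih

namespace IsInfinitePath

theorem isLowerSet (hP : IsInfinitePath S P) (hS : IsLowerSet S) : IsLowerSet P :=
  fun x y hyx hx => hP.mem_of_le x hx y (hS hyx (hP.subset hx)) hyx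

theorem of_derivative (hS : IsLowerSet S) (hP : IsInfinitePath (derivative S) P) :
    IsInfinitePath S P where
  subset := hP.subset.trans (derivative_subset S)
  infinite := hP.infinite
  isChain := hP.isChain
  mem_of_le _ hx _ _ hyx := hP.isLowerSet (isLowerSet_derivative hS) hyx hx

end IsInfinitePath

namespace IsForest

variable (hT : IsForest T)
include hT

theorem le_or_le {x y z : T} (hx : x ≤ z) (hy : y ≤ z) : x ≤ y ∨ y ≤ x :=
  (hT.isChain_Iic z).total hx hy

theorem exists_mem_not_le (hP : P.Infinite) (x : T) : ∃ q ∈ P, ¬ q ≤ x := by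
  by_contra! h
  exact hP ((hT.finite_Iic x).subset h)

theorem exists_mem_le_not_le (hP : IsInfinitePath S P) {p z : T} (hp : p ∈ P) (hpz : p ≤ z) :
    ∃ q ∈ P, p ≤ q ∧ ¬ q ≤ z := by
  obtain ⟨q, hq, hqz⟩ := hT.exists_mem_not_le hP.infinite z
  exact ⟨q, hq, (hP.isChain.total hp hq).resolve_right fun h => hqz (h.trans hpz), hqz⟩

theorem exists_isInfinitePath_of_strictMono {D : Set T} (hD : IsLowerSet D) {y : ℕ → T}
    (hy : StrictMono y) (hyD : ∀ i, y i ∈ D) (hyS : ∀ i, (S ∩ Set.Ici (y i)).Nonempty) :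
    ∃ P, IsInfinitePath D P ∧ ∀ p ∈ P, (S ∩ Set.Ici p).Nonempty := by
  refine ⟨{p | ∃ i, p ≤ y i}, ⟨?_, ?_, ?_, ?_⟩, ?_⟩
  · rintro p ⟨i, hi⟩
    exact hD hi (hyD i)
  · exact (Set.infinite_range_of_injective hy.injective).mono
      (Set.range_subset_iff.2 fun i => ⟨i, le_rfl⟩)
  · rintro p ⟨i, hi⟩ q ⟨j, hj⟩ -
    exact hT.le_or_le (hi.trans (hy.monotone (le_max_left i j)))
      (hj.trans (hy.monotone (le_max_right i j)))
  · rintro p ⟨i, hi⟩ q - hqp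
    exact ⟨i, hqp.trans hi⟩
  · rintro p ⟨i, hi⟩
    exact (hyS i).mono (Set.inter_subset_inter_right S (Set.Ici_subset_Ici.2 hi))

theorem eq_of_isInfinitePath_of_subset (hS : IsLowerSet S) (hP : IsInfinitePath S P)
    (hQ : IsInfinitePath S Q) (h : Q ⊆ P) : Q = P := by
  refine h.antisymm fun p hp => ?_
  obtain ⟨q, hq, hqp⟩ := hT.exists_mem_not_le hQ.infinite p
  exact hQ.isLowerSet hS ((hP.isChain.total hp (h hq)).resolve_right hqp) hq

theorem exists_isInfinitePath_branching_off (hS : IsLowerSet S)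
    (hP : IsInfinitePath (derivative S) P) {p : T} (hp : p ∈ P) :
    ∃ q ∈ P, p ≤ q ∧ ∃ Q, IsInfinitePath S Q ∧ ∃ z ∈ Q, Set.Ici z ⊆ Set.Ici p \ Set.Ici q := by
  have hPS : IsInfinitePath S P := hP.of_derivative hS
  have hPlower : IsLowerSet P := hPS.isLowerSet hS
  obtain ⟨Q, hQ, hne, hpQ⟩ : ∃ Q, IsInfinitePath S Q ∧ Q ≠ P ∧ p ∈ Q := by
    obtain ⟨Q, R, hQ, hR, hQR, hpQ, hpR⟩ := hP.subset hp
    by_cases h : Q = P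
    · exact ⟨R, hR, fun h' => hQR (h.trans h'.symm), hpR⟩
    · exact ⟨Q, hQ, h, hpQ⟩
  obtain ⟨z, hzQ, hzP⟩ := Set.not_subset.1 fun h =>
    hne (hT.eq_of_isInfinitePath_of_subset hS hPS hQ h)
  have hpz : p ≤ z := (hQ.isChain.total hpQ hzQ).resolve_right fun h => hzP (hPlower h hp)
  obtain ⟨q, hq, hpq, hqz⟩ := hT.exists_mem_le_not_le hPS hp hpz
  refine ⟨q, hq, hpq, Q, hQ, z, hzQ, fun t hzt => ⟨hpz.trans hzt, fun hqt => ?_⟩⟩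
  exact (hT.le_or_le hqt hzt).elim hqz fun hzq => hzP (hPlower hzq hq)

theorem hasLadderRank_succ_Ici_of_isInfinitePath {n : ℕ}
    (hP : IsInfinitePath (iterDerivative T n) P) {x : T}
    (hx : x ∈ P) : HasLadderRank (cones T) (n + 1) (Set.Ici x) := by
  induction n generalizing P x with
  | zero =>
    refine hasLadderRank_succ_Ici_of_forall_exists (fun p hp => ?_) hx
    obtain ⟨q, hq, hpq, hqp⟩ := hT.exists_mem_le_not_le hP hp le_rfl
    exact ⟨q, hq, hpq, p, le_rfl, hqp⟩
  | succ n ih =>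
    rw [iterDerivative_natCast_succ] at hP
    refine hasLadderRank_succ_Ici_of_forall_exists (fun p hp => ?_) hx
    obtain ⟨q, hq, hpq, Q, hQ, z, hz, hzpq⟩ :=
      hT.exists_isInfinitePath_branching_off (isLowerSet_iterDerivative_natCast n) hP hp
    exact ⟨q, hq, hpq, (ih hQ hz).mono hzpq⟩

theorem exists_strictMono_of_hasLadderRank {n : ℕ} (h : HasLadderRank (cones T) (n + 1) S) :
    ∃ y : ℕ → T, StrictMono y ∧
      ∀ i, HasLadderRank (cones T) n (S ∩ (Set.Ici (y i) \ Set.Ici (y (i + 1)))) := by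
  obtain ⟨f, hf, h⟩ := h
  choose y hy using hf
  obtain rfl : (fun i => Set.Ici (y i)) = f := funext hy
  refine ⟨y, strictMono_nat_of_lt_succ fun i => ?_, fun i => (h i).mono ?_⟩
  · obtain ⟨s, -, hs⟩ := (h i).nonempty
    obtain ⟨t, -, ht⟩ := (h (i + 1)).nonempty
    have hnot : ¬ y (i + 1) ≤ y i := fun hle =>
      i.not_succ_le_self ((hs (i + 1)).1 (hle.trans ((hs i).2 le_rfl)))
    exact lt_of_le_not_ge ((hT.le_or_le ((ht i).2 i.le_succ)
      ((ht (i + 1)).2 le_rfl)).resolve_right hnot) hnot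
  · rintro t ⟨htS, ht⟩
    exact ⟨htS, (ht i).2 le_rfl, fun h' => i.not_succ_le_self ((ht (i + 1)).1 h')⟩

theorem mem_of_forall_inter_Ici_nonempty (hS : IsLowerSet S) (hP : IsInfinitePath S P) {x : T}
    (h : ∀ p ∈ P, (Set.Ici x ∩ Set.Ici p).Nonempty) : x ∈ P := by
  obtain ⟨p, hp, hpx⟩ := hT.exists_mem_not_le hP.infinite x
  obtain ⟨t, hxt, hpt⟩ := h p hp
  exact hP.isLowerSet hS ((hT.le_or_le hpt hxt).resolve_left hpx) hp

theorem exists_isInfinitePath_of_hasLadderRank {n : ℕ} (h : HasLadderRank (cones T) (n + 1) S) :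
    ∃ P, IsInfinitePath (iterDerivative T n) P ∧ ∀ p ∈ P, (S ∩ Set.Ici p).Nonempty := by
  induction n generalizing S with
  | zero =>
    obtain ⟨y, hy, h⟩ := hT.exists_strictMono_of_hasLadderRank h
    refine hT.exists_isInfinitePath_of_strictMono (isLowerSet_iterDerivative_natCast 0) hy
      (fun i => ?_) fun i => (h i).nonempty.mono fun t ht => ⟨ht.1, ht.2.1⟩
    rw [Nat.cast_zero, iterDerivative_zero]
    exact Set.mem_univ _
  | succ n ih =>
    obtain ⟨y, hy, h⟩ := hT.exists_strictMono_of_hasLadderRank h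
    choose P hP hPS using fun i => ih (h i)
    have hlower := isLowerSet_iterDerivative_natCast (T := T) n
    have hmem (i : ℕ) : y i ∈ P i :=
      hT.mem_of_forall_inter_Ici_nonempty hlower (hP i) fun p hp =>
        (hPS i p hp).mono fun t ht => ⟨ht.1.2.1, ht.2⟩
    have hnotMem (i : ℕ) : y (i + 1) ∉ P i := fun hi => by
      obtain ⟨t, ⟨-, -, ht⟩, ht'⟩ := hPS i _ hi
      exact ht ht'
    refine hT.exists_isInfinitePath_of_strictMono (isLowerSet_iterDerivative_natCast (n + 1)) hy
      (fun i => ?_) fun i => (h i).nonempty.mono fun t ht => ⟨ht.1, ht.2.1⟩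
    rw [iterDerivative_natCast_succ]
    exact ⟨P i, P (i + 1), hP i, hP (i + 1), fun heq => hnotMem i (heq ▸ hmem (i + 1)), hmem i,
      (hP (i + 1)).isLowerSet hlower (hy i.lt_succ_self).le (hmem (i + 1))⟩

theorem hasLadderRank_succ_Ici_iff {n : ℕ} {x : T} :
    HasLadderRank (cones T) (n + 1) (Set.Ici x) ↔
      ∃ P, IsInfinitePath (iterDerivative T n) P ∧ x ∈ P := by
  refine ⟨fun h => ?_, fun ⟨P, hP, hx⟩ => hT.hasLadderRank_succ_Ici_of_isInfinitePath hP hx⟩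
  obtain ⟨P, hP, hPx⟩ := hT.exists_isInfinitePath_of_hasLadderRank h
  exact ⟨P, hP, hT.mem_of_forall_inter_Ici_nonempty (isLowerSet_iterDerivative_natCast n) hP hPx⟩

theorem cbRank_le_of_hasLadderRank {m : ℕ} (h : ∀ x : T,
      HasLadderRank (cones T) (m + 1) (Set.Ici x) → HasLadderRank (cones T) (m + 3) (Set.Ici x)) :
    cbRank T ≤ (m + 1 : ℕ) := by
  refine csInf_le' (Set.Subset.antisymm (fun x hx => ?_)
    (iterDerivative_antitone T (Order.le_succ _)))
  rw [iterDerivative_natCast_succ] at hx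
  obtain ⟨P, -, hP, -, -, hxP, -⟩ := hx
  obtain ⟨Q, hQ, hxQ⟩ := hT.hasLadderRank_succ_Ici_iff.1
    (h x (hT.hasLadderRank_succ_Ici_of_isInfinitePath hP hxP))
  exact_mod_cast hQ.subset hxQ

end IsForest

end PoTree

namespace WordAutomatic

variable {A : Type*}

section Convolution

variable {k : ℕ}

theorem length_convolution (x : Fin k → List A) :
    (convolution x).length = Finset.univ.sup fun i => (x i).length := by
  rw [convolution, List.length_map, List.length_range]

theorem getElem_convolution (x : Fin k → List A) {j : ℕ} (hj : j < (convolution x).length) :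
    (convolution x)[j] = fun i => (x i)[j]? := by
  simp [convolution]

theorem getElem?_convolution_bind (x : Fin k → List A) (i : Fin k) (j : ℕ) :
    ((convolution x)[j]?.bind fun a => a i) = (x i)[j]? := by
  rcases lt_or_ge j (convolution x).length with hj | hj
  · rw [List.getElem?_eq_getElem hj, getElem_convolution, Option.bind_some]
  · have hi : (x i).length ≤ j := by
      rw [length_convolution] at hj
      exact (Finset.le_sup (f := fun i => (x i).length) (Finset.mem_univ i)).trans hj
    rw [List.getElem?_eq_none hj, List.getElem?_eq_none hi, Option.bind_none]

theorem convolution_injective :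
    Function.Injective (convolution : (Fin k → List A) → List (Fin k → Option A)) := by
  intro x y h
  ext1 i
  refine List.ext_getElem? fun j => ?_
  rw [← getElem?_convolution_bind x, h, getElem?_convolution_bind]

theorem take_convolution (x : Fin k → List A) (n : ℕ) :
    (convolution x).take n = convolution fun i => (x i).take n := by
  refine List.ext_getElem ?_ fun j hj _ => ?_
  · simp only [List.length_take, length_convolution]
    exact Finset.sup_inf_distrib_left _ _ _
  · have hjn : j < n := hj.trans_le (List.length_take_le _ _)
    simp only [List.getElem_take, getElem_convolution, List.getElem?_take_of_lt hjn]

theorem drop_convolution (x : Fin k → List A) (n : ℕ) :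
    (convolution x).drop n = convolution fun i => (x i).drop n := by
  refine List.ext_getElem ?_ fun j _ _ => ?_
  · simp only [List.length_drop, length_convolution]
    exact Finset.apply_sup_eq_sup_comp_of_linearOrder (· - n)
      (fun _ _ h => Nat.sub_le_sub_right h n) (Nat.zero_sub n)
  · simp only [List.getElem_drop, getElem_convolution, List.getElem?_drop]

theorem convolution_pair_append (u w v : List A) :
    convolution ![u, w ++ v] =
      convolution ![u.take w.length, w] ++ convolution ![u.drop w.length, v] := by
  have htake : (fun i => (![u, w ++ v] i).take w.length) = ![u.take w.length, w] := by
    funext i; fin_cases i <;> simp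
  have hdrop : (fun i => (![u, w ++ v] i).drop w.length) = ![u.drop w.length, v] := by
    funext i; fin_cases i <;> simp
  rw [← htake, ← hdrop, ← take_convolution, ← drop_convolution, List.take_append_drop]

end Convolution

/-- The words `v` such that `u` is related to the extension `w ++ v` of `w`. -/
def residual (R : Set (Fin 2 → List A)) (u w : List A) : Set (List A) := {v | ![u, w ++ v] ∈ R}

/-- The family of all residuals of a binary relation after a given word `w`. Since `u` ranges
over all words and not only over the domain of `R`, the empty set may be a member. -/
def residuals (R : Set (Fin 2 → List A)) (w : List A) : Set (Set (List A)) :=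
  Set.range fun u => residual R u w

/-- The words whose convolution with `b` belongs to `K`. -/
def rightSection (K : Language (Fin 2 → Option A)) (b : List A) : Set (List A) :=
  {v | convolution ![b, v] ∈ K}

variable {R : Set (Fin 2 → List A)}

/-- The language of the convolutions of the members of a relation. -/
def convolutionLanguage (R : Set (Fin 2 → List A)) : Language (Fin 2 → Option A) :=
  convolution '' R

theorem residual_eq_rightSection (u w : List A) :
    residual R u w = rightSection
      ((convolutionLanguage R).leftQuotient (convolution ![u.take w.length, w]))
      (u.drop w.length) := by
  ext v
  rw [rightSection, Set.mem_ofPred_eq, Language.mem_leftQuotient, ← convolution_pair_append]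
  exact convolution_injective.mem_set_image.symm

theorem finite_residual_of_length_le (hR : IsRegularRel R) :
    {V | ∃ u w : List A, u.length ≤ w.length ∧ residual R u w = V}.Finite := by
  have hquot : (Set.range (convolutionLanguage R).leftQuotient).Finite :=
    Language.IsRegular.finite_range_leftQuotient hR
  refine (hquot.image fun K => rightSection K []).subset ?_
  rintro _ ⟨u, w, huw, rfl⟩
  refine ⟨_, ⟨convolution ![u.take w.length, w], rfl⟩, ?_⟩
  rw [residual_eq_rightSection u w, List.drop_eq_nil_of_le huw]

/-- The data on which the family of the residuals after `w` depends: the left quotients reached by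
the words `a` that are not longer than `w`, each marked with whether `a` has the length of `w`, so
that `a` may be continued. -/
def quotientType (R : Set (Fin 2 → List A)) (w : List A) :
    Set (Language (Fin 2 → Option A) × Prop) :=
  (fun a => ((convolutionLanguage R).leftQuotient (convolution ![a, w]), a.length = w.length)) ''
    {a | a.length ≤ w.length}

theorem residuals_eq_iUnion_quotientType (w : List A) :
    residuals R w = ⋃ q ∈ quotientType R w, rightSection q.1 '' {b | b = [] ∨ q.2} := by
  ext V
  simp only [Set.mem_iUnion₂, exists_prop]
  constructor
  · rintro ⟨u, rfl⟩
    refine ⟨_, ⟨u.take w.length, List.length_take_le _ _, rfl⟩, u.drop w.length, ?_,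
      (residual_eq_rightSection u w).symm⟩
    rcases le_total u.length w.length with h | h
    · exact .inl (List.drop_eq_nil_of_le h)
    · exact .inr (List.length_take_of_le h)
  · rintro ⟨_, ⟨a, ha, rfl⟩, b, hb, rfl⟩
    refine ⟨a ++ b, ?_⟩
    rcases hb with rfl | hb
    · simp [residual_eq_rightSection, List.take_of_length_le ha, List.drop_eq_nil_of_le ha]
    · have hb : a.length = w.length := hb
      simp [residual_eq_rightSection, ← hb]

theorem finite_range_residuals (hR : IsRegularRel R) : (Set.range (residuals R)).Finite := by
  have hquot : (Set.range (convolutionLanguage R).leftQuotient).Finite :=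
    Language.IsRegular.finite_range_leftQuotient hR
  have htype : (Set.range (quotientType R)).Finite := by
    refine (hquot.prod Set.finite_univ).powerset.subset ?_
    rintro _ ⟨w, rfl⟩ _ ⟨a, -, rfl⟩
    exact ⟨⟨_, rfl⟩, Set.mem_univ _⟩
  refine (htype.image fun τ => ⋃ q ∈ τ, rightSection q.1 '' {b | b = [] ∨ q.2}).subset ?_
  rintro _ ⟨w, rfl⟩
  exact ⟨_, ⟨w, rfl⟩, (residuals_eq_iUnion_quotientType w).symm⟩

section Presentation

variable {T : Type*}

/-- The relation on words that corresponds to the order of `T` under the naming `ρ`. -/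
def leRel [LE T] (ρ : T → List A) : Set (Fin 2 → List A) :=
  {w | ∃ x y : T, x ≤ y ∧ w = ![ρ x, ρ y]}

theorem mem_leRel [LE T] {ρ : T → List A} {u v : List A} :
    ![u, v] ∈ leRel ρ ↔ ∃ x y : T, x ≤ y ∧ u = ρ x ∧ v = ρ y := by
  simp [leRel]

variable [Preorder T] {ρ : T → List A}

theorem image_append_residual_leRel (hρ : Function.Injective ρ) (x : T) (w : List A) :
    (w ++ ·) '' residual (leRel ρ) (ρ x) w = ρ '' {t ∈ Set.Ici x | w <+: ρ t} := by
  ext v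
  constructor
  · rintro ⟨v, hv, rfl⟩
    obtain ⟨x', t, hxt, hx, ht⟩ := mem_leRel.1 hv
    obtain rfl := hρ hx
    exact ⟨t, ⟨hxt, v, ht⟩, ht.symm⟩
  · rintro ⟨t, ⟨hxt, v, hv⟩, rfl⟩
    exact ⟨v, mem_leRel.2 ⟨x, t, hxt, rfl, hv⟩, hv⟩

theorem hasLadderRank_residuals_nil (hρ : Function.Injective ρ) {n : ℕ} {S : Set T} :
    HasLadderRank (residuals (leRel ρ) []) n (ρ '' S) ↔ HasLadderRank (PoTree.cones T) n S := by
  have hpre (x : T) : ρ ⁻¹' residual (leRel ρ) (ρ x) [] = Set.Ici x := by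
    ext t
    simp [residual, mem_leRel, hρ.eq_iff]
  rw [hasLadderRank_image]
  constructor <;> refine fun h => h.mono_family ?_
  · rintro _ ⟨_, ⟨u, rfl⟩, rfl⟩ ⟨t, ht⟩
    obtain ⟨x, -, -, rfl, -⟩ := mem_leRel.1 ht
    exact ⟨x, (hpre x).symm⟩
  · rintro _ ⟨x, rfl⟩ -
    exact ⟨_, ⟨ρ x, rfl⟩, hpre x⟩

theorem hasLadderRank_residuals_iff (hρ : Function.Injective ρ) {n : ℕ} {x : T} {w : List A} :
    HasLadderRank (residuals (leRel ρ) w) n (residual (leRel ρ) (ρ x) w) ↔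
      HasLadderRank (PoTree.cones T) n {t ∈ Set.Ici x | w <+: ρ t} := by
  have hfamily : residuals (leRel ρ) w = Set.preimage (w ++ ·) '' residuals (leRel ρ) [] :=
    Set.range_comp (Set.preimage (w ++ ·)) fun u => residual (leRel ρ) u []
  rw [hfamily, ← hasLadderRank_image, image_append_residual_leRel hρ,
    hasLadderRank_residuals_nil hρ]

theorem exists_forall_hasLadderRank_Ici [Finite A] (hρ : Function.Injective ρ)
    (hle : IsRegularRel (leRel ρ)) :
    ∃ m : ℕ, ∀ x : T, HasLadderRank (PoTree.cones T) (m + 1) (Set.Ici x) →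
      ∀ n, HasLadderRank (PoTree.cones T) n (Set.Ici x) := by
  obtain ⟨m, hm⟩ := exists_nat_forall_of_antitone
    ((finite_range_residuals hle).prod (finite_residual_of_length_le hle))
    (p := fun τ n => HasLadderRank τ.1 n τ.2) fun τ _ => HasLadderRank.antitone τ.1 τ.2
  refine ⟨m, fun x hx n => ?_⟩
  obtain ⟨w, hw, hxw⟩ := hx.exists_isPrefix hρ (ρ x).length
  have hrank := hm (residuals (leRel ρ) w, residual (leRel ρ) (ρ x) w)
    ⟨⟨w, rfl⟩, ρ x, w, hw.ge, rfl⟩ ((hasLadderRank_residuals_iff hρ).2 hxw.of_succ) n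
  exact ((hasLadderRank_residuals_iff hρ).1 hrank).mono fun t ht => ht.1

end Presentation

end WordAutomatic

theorem mainTheorem9_general {A : Type*} [Finite A] {T : Type*} [PartialOrder T]
    (hT : PoTree.IsForest T) (ρ : T → List A) (hρ : Function.Injective ρ)
    (hle : WordAutomatic.IsRegularRel (WordAutomatic.leRel ρ)) :
    ∃ n : ℕ, PoTree.cbRank T = (n : Ordinal) := by
  obtain ⟨m, hm⟩ := WordAutomatic.exists_forall_hasLadderRank_Ici hρ hle
  have hrank : PoTree.cbRank T ≤ (m + 1 : ℕ) := hT.cbRank_le_of_hasLadderRank fun x hx => hm x hx _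
  exact Ordinal.lt_omega0.1 (hrank.trans_lt (Ordinal.natCast_lt_omega0 _))

theorem mainTheorem9 {A : Type*} [Finite A] {T : Type*} [PartialOrder T]
    (hT : PoTree.IsTree T) (ρ : T → List A) (hρ : WordAutomatic.IsPresentation ρ) :
    ∃ n : ℕ, PoTree.cbRank T = (n : Ordinal) :=
  mainTheorem9_general hT.isForest ρ hρ.injective hρ.le_regular
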